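/- Let $K$ be an infinite field, $n\ge 0$, and let $E=K\langle e_1,\dots,e_n\rangle$ be the exterior algebra, with monomials $e_F=e_{i_1}\wedge\dots\wedge e_{i_r}$ for $F=\{i_1<\dots<i_r\}\subseteq[n]=\{1,\dots,n\}$. Let $\Delta$ be a simplicial complex on $[n]$, i.e. a family of subsets of $[n]$ closed under passing to subsets, let $J_\Delta=(e_F : F\notin\Delta)\subseteq E$ and $K\{\Delta\}=E/J_\Delta$. **Generic initial ideal.** Let $<$ be the reverse lexicographic order on monomials with respect to $e_1<\dots<e_n$: $e_A<e_B$ if $|A|<|B|$, or if $|A|=|B|$ and $\min(A\triangle B)\in A$. For an ideal $J\subseteq E$, $\mathrm{in}(J)$ is the ideal generated by the initial ($<$-largest) monomials of the nonzero elements of $J$. An ideal $I$ is a generic initial ideal of $J$ if there is a non-empty Zariski-open set $U\subseteq \mathrm{GL}_n(K)$ with $\mathrm{in}(g(J))=I$ for all $g\in U$, where $g$ acts on $E$ by $e_j\mapsto\sum_i g_{ij}e_i$; if there is exactly one such $I$, it is denoted $\mathrm{gin}(J)$. **Annihilator numbers.** For a graded $E$-module $M$ and $v\in E_1$ let $H^j(M,v)$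 be the cohomology at $M_j$ of the complex $\cdots\to M_{j-1}\xrightarrow{v}M_j\xrightarrow{v}M_{j+1}\to\cdots$. For a graded ideal $J\subseteq E$, $1\le i\le n$ and $j\in\mathbb Z$ put $$\alpha_{i,j}(E/J)=\dim_K H^j\bigl(M/(e_1,\dots,e_{i-1})M,\;e_i\bigr),\qquad M=E/\mathrm{gin}(J).$$ **Exterior shifting.** Let $K'/K$ be a field extension containing elements $a_{kl}$ ($1\le k,l\le n$) that are algebraically independent over $K$, let $f_k=\sum_{l}a_{kl}e_l$ in $E'=K'\otimes_K E$, $f_A=f_{i_1}\wedge\dots\wedge f_{i_r}$ for $A=\{i_1<\dots<i_r\}$, and let $\bar f_A$ be the image of $f_A$ in $K'\{\Delta\}=E'/J_\Delta E'$. Then $\Delta^e$ is the family of all $A\subseteq[n]$ with $0\le|A|\le\dim\Delta+1$ such that $$\bar f_A\notin\mathrm{span}_{K'}\{\bar f_B : |B|=|A|,\ \min(A\triangle B)\in B\}.$$ Here $\dim\Delta+1$ is the largest size of a face of $\Delta$ (if $\Delta$ has no face at all, $\Delta^e$ is empty). **Statement.** The ideal $J_\Delta$ has exactly one generic initial ideal,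 and for all $1\le i\le n$ and $j\in\mathbb Z$ $$\alpha_{i,j}(K\{\Delta\})=\bigl|\{F\in\Delta^e : |F|=j,\ [i]\cap F=\emptyset,\ F\cup\{i\}\notin\Delta^e\}\bigr|.$$ -/

import Mathlib

namespace ExteriorShifting

/-- The exterior algebra `E = K⟨e_1, …, e_n⟩`; the index set `[n]` is `Fin n`. -/
abbrev Ext (K : Type*) [Field K] (n : ℕ) : Type _ := ExteriorAlgebra K (Fin n → K)

/-- The linear form `v_1 e_1 + … + v_n e_n` with coefficient vector `v`, as an element of `E`. -/
noncomputable abbrev linForm {K : Type*} [Field K] {n : ℕ} (v : Fin n → K) : Ext K n :=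
  ExteriorAlgebra.ι K v

/-- The coefficient vectors of the standard basis `e_1, …, e_n` of `E_1`. -/
def stdBasis (K : Type*) [Field K] (n : ℕ) (i : Fin n) : Fin n → K := Pi.single i 1

/-- `f_A = f_{i_1} ∧ … ∧ f_{i_r}` for `A = {i_1 < … < i_r}`, where `f_1, …, f_n` are the linear
forms with coefficient vectors `v 1, …, v n`. -/
noncomputable def wedge {K : Type*} [Field K] {n : ℕ} (v : Fin n → (Fin n → K))
    (A : Finset (Fin n)) : Ext K n :=
  ExteriorAlgebra.ιMulti K A.card (fun k => v (A.orderEmbOfFin rfl k))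

/-- The monomial `e_A`. -/
noncomputable def mono (K : Type*) [Field K] {n : ℕ} (A : Finset (Fin n)) : Ext K n :=
  wedge (stdBasis K n) A

/-- The `K`-basis of `E` consisting of the monomials. -/
noncomputable def monoBasis (K : Type*) [Field K] (n : ℕ) :
    Module.Basis (Finset (Fin n)) K (Ext K n) :=
  (Pi.basisFun K (Fin n)).ExteriorAlgebra

theorem monoBasis_apply (K : Type*) [Field K] (n : ℕ) (A : Finset (Fin n)) :
    monoBasis K n A = mono K A := by
  unfold monoBasis mono wedge
  rw [ExteriorAlgebra.basis_apply]
  have h : ∀ k, (Pi.basisFun K (Fin n)) k = stdBasis K n k := fun k => by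
    simp [stdBasis]
  exact congrArg (ExteriorAlgebra.ιMulti K A.card) (funext fun k => h _)

/-- `A <_lex B`, meant for sets of equal size: `min (A ∆ B) ∈ A`. -/
def LexLT {n : ℕ} (A B : Finset (Fin n)) : Prop :=
  ∃ a ∈ symmDiff A B, (∀ c ∈ symmDiff A B, a ≤ c) ∧ a ∈ A

/-- The (graded) reverse lexicographic order on monomials with respect to `e_1 < … < e_n`:
`e_A < e_B` if the degree of `e_A` is smaller, or if the degrees agree and the smallest variable
that occurs in exactly one of the two monomials occurs in `e_A`. -/
def RevLexLT {n : ℕ} (A B : Finset (Fin n)) : Prop :=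
  A.card < B.card ∨ (A.card = B.card ∧ LexLT A B)

/-- `e_A` is the initial (that is, the largest) monomial of `f`. -/
def IsInitialMonomial {K : Type*} [Field K] {n : ℕ} (f : Ext K n) (A : Finset (Fin n)) : Prop :=
  (monoBasis K n).repr f A ≠ 0 ∧
    ∀ B, (monoBasis K n).repr f B ≠ 0 → B ≠ A → RevLexLT B A

/-- The initial ideal of `J`, generated by the initial monomials of the elements of `J`.
Ideals of `E` are left ideals here; a left ideal generated by homogeneous elements of `E` is
automatically two-sided. -/
noncomputable def initialIdeal {K : Type*} [Field K] {n : ℕ} (J : Ideal (Ext K n)) :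
    Ideal (Ext K n) :=
  Ideal.span {m | ∃ f ∈ J, ∃ A, IsInitialMonomial f A ∧ m = mono K A}

/-- The automorphism of `E` induced by `g ∈ GL_n(K)`, that is `e_j ↦ ∑ i, g i j • e_i`. -/
noncomputable def linAut {K : Type*} [Field K] {n : ℕ} (g : Matrix.GeneralLinearGroup (Fin n) K) :
    Ext K n →ₐ[K] Ext K n :=
  ExteriorAlgebra.map (Matrix.toLin' (g : Matrix (Fin n) (Fin n) K))

/-- Zariski-open subsets of `GL_n(K)`: the complements of the zero sets of families of
polynomials in the matrix entries. -/
def IsZariskiOpen {K : Type*} [Field K] {n : ℕ} (U : Set (Matrix.GeneralLinearGroup (Fin n) K)) :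
    Prop :=
  ∃ S : Set (MvPolynomial (Fin n × Fin n) K), ∀ g : Matrix.GeneralLinearGroup (Fin n) K,
    g ∈ U ↔ ∃ p ∈ S,
      MvPolynomial.eval (fun q => (g : Matrix (Fin n) (Fin n) K) q.1 q.2) p ≠ 0

/-- `I` is a generic initial ideal of `J`: the initial ideal of `g(J)` is `I` for all `g` in some
non-empty Zariski-open subset of `GL_n(K)`. -/
def IsGin {K : Type*} [Field K] {n : ℕ} (J I : Ideal (Ext K n)) : Prop :=
  ∃ U : Set (Matrix.GeneralLinearGroup (Fin n) K), U.Nonempty ∧ IsZariskiOpen U ∧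
    ∀ g ∈ U, initialIdeal (J.map (linAut g)) = I

/-- The generic initial ideal of `J` with respect to the reverse lexicographic order. -/
noncomputable def gin {K : Type*} [Field K] {n : ℕ} (J : Ideal (Ext K n)) : Ideal (Ext K n) :=
  Classical.epsilon (IsGin J)

/-- The homogeneous component `E_j`, `j ∈ ℤ` (zero for negative `j`). -/
noncomputable def extPiece (K : Type*) [Field K] (n : ℕ) (j : ℤ) : Submodule K (Ext K n) :=
  ⨆ k : ℕ, ⨆ _ : (k : ℤ) = j, ⋀[K]^k (Fin n → K)

/-- The grading that a quotient `M ⧸ P` inherits from a grading `𝓜` of `M`. -/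
noncomputable def quotGrading {K : Type*} [Field K] {n : ℕ} {M : Type*} [AddCommGroup M]
    [Module K M] [Module (Ext K n) M] [IsScalarTower K (Ext K n) M]
    (𝓜 : ℤ → Submodule K M) (P : Submodule (Ext K n) M) (j : ℤ) : Submodule K (M ⧸ P) :=
  (𝓜 j).map (P.mkQ.restrictScalars K)

/-- The `K`-dimension of the cohomology `H^j(M, v)` of the complex
`⋯ → M_{j-1} → M_j → M_{j+1} → ⋯` given by multiplication with `v`: the dimension of
`{m ∈ M_j | v m = 0} / v M_{j-1}`. -/
noncomputable def cohomDim {K : Type*} [Field K] {n : ℕ} {M : Type*} [AddCommGroup M]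
    [Module K M] [Module (Ext K n) M] [IsScalarTower K (Ext K n) M]
    (𝓜 : ℤ → Submodule K M) (v : Ext K n) (j : ℤ) : ℕ :=
  Module.finrank K
    (↥(𝓜 j ⊓ LinearMap.ker (Algebra.lsmul K K M v)) ⧸
      ((𝓜 (j - 1)).map (Algebra.lsmul K K M v)).submoduleOf
        (𝓜 j ⊓ LinearMap.ker (Algebra.lsmul K K M v)))

/-- The exterior annihilator numbers
`α_{i,j}(v_1, …, v_n; M) = dim_K H^j(M / (v_1, …, v_{i-1}) M, v_i)` of a graded module `M` with
respect to a basis `v_1, …, v_n` of `E_1`. -/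
noncomputable def annihilatorNumber {K : Type*} [Field K] {n : ℕ} {M : Type*} [AddCommGroup M]
    [Module K M] [Module (Ext K n) M] [IsScalarTower K (Ext K n) M]
    (𝓜 : ℤ → Submodule K M) (v : Fin n → (Fin n → K)) (i : Fin n) (j : ℤ) : ℕ :=
  cohomDim
    (quotGrading 𝓜
      (Ideal.span {x : Ext K n | ∃ k < i, x = linForm (v k)} • (⊤ : Submodule (Ext K n) M)))
    (linForm (v i)) j

/-- The exterior generic annihilator numbers
`α_{i,j}(E/J) = α_{i,j}(e_1, …, e_n; E / gin J)` for a graded ideal `J`. -/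
noncomputable def genericAnnihilatorNumber {K : Type*} [Field K] {n : ℕ} (J : Ideal (Ext K n))
    (i : Fin n) (j : ℤ) : ℕ :=
  annihilatorNumber (quotGrading (extPiece K n) (gin J)) (stdBasis K n) i j

/-- The exterior face ideal `J_Δ`, generated by the monomials `e_F` with `F ∉ Δ`.  A simplicial
complex on the vertex set `[n]` is a family of subsets of `[n]` that is closed under passing to
subsets. -/
noncomputable def faceIdeal (K : Type*) [Field K] {n : ℕ} (Δ : LowerSet (Finset (Fin n))) :
    Ideal (Ext K n) :=
  Ideal.span {m | ∃ F, F ∉ Δ ∧ m = mono K F}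

/-- The sets `A` of size `r` such that the class of `f_A` in `K'{Δ} = E'/J_Δ` is not in the
`K'`-span of the classes of the `f_B` with `|B| = r` and `B <_lex A`, where `f_1, …, f_n` are the
linear forms given by the rows of the matrix `a`. -/
def shiftedFamily {K' : Type*} [Field K'] {n : ℕ} (a : Matrix (Fin n) (Fin n) K')
    (Δ : LowerSet (Finset (Fin n))) (r : ℕ) : Set (Finset (Fin n)) :=
  {A | A.card = r ∧
    Submodule.Quotient.mk (p := faceIdeal K' Δ) (wedge a A) ∉
      Submodule.span K' {y | ∃ B : Finset (Fin n), B.card = r ∧ LexLT B A ∧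
        y = Submodule.Quotient.mk (p := faceIdeal K' Δ) (wedge a B)}}

/-- The exterior shifting of `Δ` computed with the matrix `a` (which is meant to be generic): the
union of the shifted families in the sizes `0 ≤ r ≤ dim Δ + 1`, that is, the sizes that do not
exceed the size of some face of `Δ`. -/
def exteriorShifting {K' : Type*} [Field K'] {n : ℕ} (a : Matrix (Fin n) (Fin n) K')
    (Δ : LowerSet (Finset (Fin n))) : Set (Finset (Fin n)) :=
  {A | ∃ r, (∃ G ∈ Δ, r ≤ G.card) ∧ A ∈ shiftedFamily a Δ r}

end ExteriorShifting

/-!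
The proof identifies the generic initial ideal of `J_Δ` with `J_{Δ^e}` and then reads off the
annihilator numbers of a quotient by a face ideal.

*Standard monomials and shifting.* For `g ∈ GL_n(K)` an element `f` lies in `g(J_Δ)` if and only if
`g⁻¹ f ∈ J_Δ`. Since `g⁻¹` sends `e_A` to `f_A`, where `f_1, …, f_n` are given by the rows of
`b = (g⁻¹)ᵀ`, the monomial `e_A` is an initial monomial of `g(J_Δ)` exactly when the class of `f_A`
in `K{Δ}` is a combination of the classes of smaller `f_B`. So the standard monomials of `g(J_Δ)`
form the shifted family of `b` (`mem_shiftedFamily_iff_not_initial`).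

*Genericity.* In coordinates, membership in a shifted family is the inconsistency of a linear system
whose coefficients are minors of `b` (`mem_shiftedFamily_iff`). For the matrix of indeterminates
this system either has a solution or is refuted by a separating linear form; after clearing
denominators either one is a polynomial identity with a leading factor `q ≠ 0`
(`exists_span_certificate`), which can be evaluated at every matrix over every extension of `K` at
which `q` does not vanish. This covers both the matrix `a` with algebraically independent entries
and the points of a non-empty open set over the infinite field `K`
(`exists_generic_shiftedFamily`). Hence there is an open set of `g` for which
`in(g(J_Δ)) = J_{Δ^e}` (`exists_isGin_faceIdeal`), and non-empty open sets meet (`IsGin.unique`).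

*Annihilator numbers.* The quotient of `E / J_Γ` by `e_k`, `k < i`, is `K{Γ'}`, where `Γ'` consists
of the faces of `Γ` with all vertices `≥ i` (`mk_mem_smul_top_iff`). It has the faces of `Γ'` as a
basis, on which `e_i` acts by adjoining the vertex `i` up to a non-zero scalar, so that the
cohomology can be counted (`cohomDim_of_ker_eq_faceIdeal`).
-/

namespace ExteriorShifting

open Module

/-! ### Monomials, face ideals and minors -/

section Monomials

variable {K : Type*} [Field K] {n : ℕ}

theorem wedge_mem_exteriorPower (v : Fin n → (Fin n → K)) (A : Finset (Fin n)) :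
    wedge v A ∈ ⋀[K]^A.card (Fin n → K) :=
  ExteriorAlgebra.ιMulti_range K _ ⟨_, rfl⟩

theorem mono_mul_mono_of_not_disjoint {S T : Finset (Fin n)} (h : ¬ Disjoint S T) :
    mono K S * mono K T = 0 := by
  simp only [← monoBasis_apply]
  exact ExteriorAlgebra.basis_mul_of_not_disjoint (Pi.basisFun K (Fin n))
    (Set.powersetCard.ofCard (s := S) rfl) (Set.powersetCard.ofCard (s := T) rfl) h

theorem exists_mono_mul_mono {S T : Finset (Fin n)} (h : Disjoint S T) :
    ∃ ε : K, ε ≠ 0 ∧ mono K S * mono K T = ε • mono K (S ∪ T) := by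
  have := ExteriorAlgebra.basis_mul_of_disjoint (Pi.basisFun K (Fin n))
    (Set.powersetCard.ofCard (s := S) rfl) (Set.powersetCard.ofCard (s := T) rfl) h
  set σ := Equiv.Perm.sign (Set.powersetCard.permOfDisjoint
    (s := Set.powersetCard.ofCard (s := S) rfl) (t := Set.powersetCard.ofCard (s := T) rfl) h)
  refine ⟨((σ : ℤ) : K), ?_, ?_⟩
  · rcases Int.units_eq_one_or σ with h | h <;> simp [h]
  · rw [← Finset.disjUnion_eq_union S T h]
    simp only [← monoBasis_apply]
    refine this.trans ?_
    rw [Units.smul_def, ← Int.cast_smul_eq_zsmul K]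
    rfl

theorem mono_singleton (i : Fin n) : mono K {i} = linForm (stdBasis K n i) := by
  have : ∀ k, ({i} : Finset (Fin n)).orderEmbOfFin rfl k = i := fun k =>
    Finset.mem_singleton.1 (Finset.orderEmbOfFin_mem _ rfl k)
  unfold mono wedge
  simp [ExteriorAlgebra.ιMulti_apply, this]

theorem exists_mono_eq_mul {i : Fin n} {F : Finset (Fin n)} (hi : i ∈ F) :
    ∃ ε : K, ε ≠ 0 ∧ mono K {i} * mono K (F.erase i) = ε • mono K F := by
  have := exists_mono_mul_mono (K := K) (S := {i}) (T := F.erase i) (by simp)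
  rwa [← Finset.insert_eq, Finset.insert_erase hi] at this

/-- The coordinates of a product `x f` vanish on a lower set of monomials if those of `f` do. -/
theorem repr_mul_eq_zero (Δ : LowerSet (Finset (Fin n))) (x f : Ext K n)
    (hf : ∀ F ∈ Δ, (monoBasis K n).repr f F = 0) {F : Finset (Fin n)} (hF : F ∈ Δ) :
    (monoBasis K n).repr (x * f) F = 0 := by
  rw [← (monoBasis K n).sum_repr x, ← (monoBasis K n).sum_repr f, Finset.sum_mul_sum]
  simp only [map_sum, Finsupp.coe_finsetSum, Finset.sum_apply, smul_mul_smul_comm, map_smul,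
    Finsupp.smul_apply]
  refine Finset.sum_eq_zero fun S _ => Finset.sum_eq_zero fun T _ => ?_
  by_cases hT : T ∈ Δ
  · simp [hf T hT]
  · rw [monoBasis_apply, monoBasis_apply]
    by_cases hd : Disjoint S T
    · obtain ⟨ε, -, h⟩ := exists_mono_mul_mono (K := K) hd
      have : S ∪ T ≠ F := by
        rintro rfl
        exact hT (Δ.lower Finset.subset_union_right hF)
      rw [h, ← monoBasis_apply, map_smul, Basis.repr_self]
      simp [Finsupp.single_eq_of_ne this.symm]
    · simp [mono_mul_mono_of_not_disjoint hd]

theorem mem_faceIdeal_iff {Δ : LowerSet (Finset (Fin n))} {f : Ext K n} :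
    f ∈ faceIdeal K Δ ↔ ∀ F ∈ Δ, (monoBasis K n).repr f F = 0 := by
  constructor
  · intro hf
    refine Submodule.span_induction (p := fun f _ => ∀ F ∈ Δ, (monoBasis K n).repr f F = 0)
      ?_ ?_ ?_ ?_ hf
    · rintro _ ⟨G, hG, rfl⟩ F hF
      rw [← monoBasis_apply, Basis.repr_self, Finsupp.single_eq_of_ne]
      rintro rfl
      exact hG hF
    · simp
    · intro x y _ _ hx hy F hF
      simp [hx F hF, hy F hF]
    · intro x y _ hy F hF
      exact repr_mul_eq_zero Δ x y hy hF
  · intro h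
    rw [← (monoBasis K n).sum_repr f]
    refine sum_mem fun F _ => ?_
    by_cases hF : F ∈ Δ
    · simp [h F hF]
    · rw [monoBasis_apply, ← algebraMap_smul (Ext K n)]
      exact Submodule.smul_mem _ _ (Ideal.subset_span ⟨F, hF, rfl⟩)

/-- Multiplication by `e_i` in coordinates. The scalar `ε` is a sign; only `ε ≠ 0` matters. -/
theorem exists_repr_mono_singleton_mul {i : Fin n} {C : Finset (Fin n)} (hi : i ∈ C) :
    ∃ ε : K, ε ≠ 0 ∧ ∀ f : Ext K n,
      (monoBasis K n).repr (mono K {i} * f) C = ε * (monoBasis K n).repr f (C.erase i) := by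
  obtain ⟨ε, hε, h⟩ := exists_mono_eq_mul (K := K) hi
  refine ⟨ε, hε, fun f => ?_⟩
  suffices H : (monoBasis K n).coord C ∘ₗ LinearMap.mulLeft K (mono K {i}) =
      ε • (monoBasis K n).coord (C.erase i) from LinearMap.congr_fun H f
  refine (monoBasis K n).ext fun T => ?_
  simp only [LinearMap.comp_apply, LinearMap.mulLeft_apply, LinearMap.smul_apply,
    Basis.coord_apply, Basis.repr_self, smul_eq_mul]
  by_cases hT : T = C.erase i
  · subst hT
    rw [monoBasis_apply, h, ← monoBasis_apply, map_smul, Basis.repr_self]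
    simp
  · rw [Finsupp.single_eq_of_ne (Ne.symm hT), mul_zero, monoBasis_apply]
    by_cases hiT : i ∈ T
    · rw [mono_mul_mono_of_not_disjoint (by simpa using hiT)]
      simp
    · obtain ⟨δ, -, h'⟩ := exists_mono_mul_mono (K := K) (S := {i}) (T := T) (by simpa using hiT)
      rw [h', ← monoBasis_apply, map_smul, Basis.repr_self, Finsupp.smul_apply,
        Finsupp.single_eq_of_ne, smul_zero]
      rintro rfl
      apply hT
      rw [← Finset.insert_eq, Finset.erase_insert hiT]

theorem repr_mono_singleton_mul_of_notMem {i : Fin n} {C : Finset (Fin n)} (hi : i ∉ C)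
    (f : Ext K n) : (monoBasis K n).repr (mono K {i} * f) C = 0 := by
  suffices H : (monoBasis K n).coord C ∘ₗ LinearMap.mulLeft K (mono K {i}) = 0 from
    LinearMap.congr_fun H f
  refine (monoBasis K n).ext fun T => ?_
  simp only [LinearMap.comp_apply, LinearMap.mulLeft_apply, LinearMap.zero_apply,
    Basis.coord_apply, monoBasis_apply]
  by_cases hiT : i ∈ T
  · rw [mono_mul_mono_of_not_disjoint (by simpa using hiT)]
    simp
  · obtain ⟨δ, -, h'⟩ := exists_mono_mul_mono (K := K) (S := {i}) (T := T) (by simpa using hiT)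
    rw [h', ← monoBasis_apply, map_smul, Basis.repr_self, Finsupp.smul_apply,
      Finsupp.single_eq_of_ne, smul_zero]
    rintro rfl
    simp at hi

/-- The entry of the compound matrix of `b` with row `A` and column `F`: the minor of `b` with
rows `A` and columns `F`, which is `0` by convention if `A` and `F` differ in size. -/
def compoundEntry {R : Type*} [CommRing R] (b : Matrix (Fin n) (Fin n) R)
    (A F : Finset (Fin n)) : R :=
  if h : F.card = A.card then (b.submatrix (A.orderEmbOfFin rfl) (F.orderEmbOfFin h)).det else 0

theorem map_compoundEntry {R S : Type*} [CommRing R] [CommRing S] (φ : R →+* S)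
    (b : Matrix (Fin n) (Fin n) R) (A F : Finset (Fin n)) :
    φ (compoundEntry b A F) = compoundEntry (b.map φ) A F := by
  unfold compoundEntry
  split_ifs
  · rw [RingHom.map_det]
    rfl
  · exact map_zero φ

theorem compoundEntry_of_card_ne {R : Type*} [CommRing R] (b : Matrix (Fin n) (Fin n) R)
    {A F : Finset (Fin n)} (h : F.card ≠ A.card) : compoundEntry b A F = 0 :=
  dif_neg h

theorem repr_wedge (b : Matrix (Fin n) (Fin n) K) (A F : Finset (Fin n)) :
    (monoBasis K n).repr (wedge b A) F = compoundEntry b A F := by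
  have hmem := wedge_mem_exteriorPower b A
  have key : (monoBasis K n).repr (wedge b A) F =
      ((DirectSum.Decomposition.isInternal (fun m => ⋀[K]^m (Fin n → K))).collectedBasis
        (Pi.basisFun K (Fin n)).exteriorPower).repr (wedge b A)
          (Set.powersetCard.prodEquiv.symm F) := by
    simp [monoBasis, Basis.ExteriorAlgebra]
  rw [key, compoundEntry]
  split_ifs with h
  · have hF : Set.powersetCard.prodEquiv.symm F =
        ⟨A.card, (⟨F, h⟩ : Set.powersetCard (Fin n) A.card)⟩ := by
      rw [Equiv.symm_apply_eq]
      rfl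
    rw [hF, DirectSum.IsInternal.collectedBasis_repr_of_mem _ _ hmem,
      exteriorPower.basis_repr_apply]
    refine (exteriorPower.ιMultiDual_apply_ιMulti K A.card (Pi.basisFun K (Fin n)) ⟨F, h⟩
      fun k => b (A.orderEmbOfFin rfl k)).trans ?_
    simp [Matrix.submatrix, Set.powersetCard.ofFinEmbEquiv_symm_apply]
  · exact DirectSum.IsInternal.collectedBasis_repr_of_mem_ne _ _ (Ne.symm h) hmem

theorem extPiece_eq_span (j : ℤ) :
    extPiece K n j = Submodule.span K (monoBasis K n '' {F | (F.card : ℤ) = j}) := by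
  have key : ∀ k : ℕ, ⋀[K]^k (Fin n → K) =
      Submodule.span K (monoBasis K n '' {F | F.card = k}) := fun k => by
    rw [← exteriorPower.ιMulti_family_span_fixedDegree_of_span K (v := Pi.basisFun K (Fin n))
      (Basis.span_eq _)]
    congr 1
    ext x
    constructor
    · rintro ⟨s, rfl⟩
      exact ⟨s.1, s.2, ExteriorAlgebra.basis_apply_powersetCard _ s⟩
    · rintro ⟨F, hF, rfl⟩
      exact ⟨⟨F, hF⟩, (ExteriorAlgebra.basis_apply_powersetCard _ ⟨F, hF⟩).symm⟩
  refine le_antisymm (iSup₂_le fun k hk => ?_) (Submodule.span_le.2 ?_)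
  · subst hk
    rw [key]
    exact Submodule.span_mono (Set.image_mono fun F (hF : F.card = k) => by simp [hF])
  · rintro _ ⟨F, hF, rfl⟩
    refine Submodule.mem_iSup_of_mem F.card (Submodule.mem_iSup_of_mem hF ?_)
    rw [monoBasis_apply]
    exact wedge_mem_exteriorPower _ F

end Monomials

/-! ### Genericity of the shifted families -/

section Generic

/-- Over a domain, whether a vector is in the span of other vectors is certified by
identities over the domain itself: after multiplication by some `q ≠ 0` there is
either a linear relation or a linear form that separates the vector from the others. -/
theorem exists_span_certificate {R ι κ : Type*} [CommRing R] [IsDomain R] [Fintype ι] [Fintype κ]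
    (m : ι → κ → R) (S : Set ι) (v : κ → R) :
    ∃ q : R, q ≠ 0 ∧
      ((∃ c : ι → R, (∀ B ∉ S, c B = 0) ∧ ∀ k, q * v k = ∑ B, c B * m B k) ∨
        ∃ l : κ → R, (∀ B ∈ S, ∑ k, l k * m B k = 0) ∧ ∑ k, l k * v k = q) := by
  classical
  set F := FractionRing R
  let w : ι → κ → F := fun B k => algebraMap R F (m B k)
  let u : κ → F := fun k => algebraMap R F (v k)
  have hinj : Function.Injective (algebraMap R F) := IsFractionRing.injective R F
  by_cases hu : u ∈ Submodule.span F (w '' S)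
  · obtain ⟨c, hc, hcu⟩ := (Finsupp.mem_span_image_iff_linearCombination F).1 hu
    obtain ⟨q, hq⟩ := IsLocalization.exist_integer_multiples_of_finite (nonZeroDivisors R)
      (fun B => c B)
    choose d hd using hq
    refine ⟨q, nonZeroDivisors.coe_ne_zero q, Or.inl ⟨d, fun B hB => ?_, fun k => ?_⟩⟩
    · apply hinj
      have : c B = 0 := by
        by_contra h
        exact hB (hc (Finsupp.mem_support_iff.2 h))
      rw [hd B, this, smul_zero, map_zero]
    · apply hinj
      have h1 : u k = ∑ B, c B * w B k := by
        rw [← hcu, Finsupp.linearCombination_apply, Finsupp.sum_fintype _ _ (by simp)]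
        simp
      simp only [map_mul, map_sum, hd]
      change algebraMap R F q * u k = _
      rw [h1, Finset.mul_sum]
      refine Finset.sum_congr rfl fun B _ => ?_
      rw [Algebra.smul_def, mul_assoc]
  · obtain ⟨f, hfu, hf⟩ := Submodule.exists_dual_map_eq_bot_of_notMem hu inferInstance
    have hsum : ∀ x : κ → F, f x = ∑ k, f (Pi.single k 1) * x k := fun x => by
      conv_lhs => rw [pi_eq_sum_univ' x]
      rw [map_sum]
      refine Finset.sum_congr rfl fun k _ => ?_
      rw [map_smul, smul_eq_mul, mul_comm]
    obtain ⟨q, hq⟩ := IsLocalization.exist_integer_multiples_of_finite (nonZeroDivisors R)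
      (fun k => f (Pi.single k 1))
    choose l hl using hq
    have hlx : ∀ x : κ → R,
        algebraMap R F (∑ k, l k * x k) = algebraMap R F q * f (fun k => algebraMap R F (x k)) := by
      intro x
      rw [hsum, Finset.mul_sum, map_sum]
      refine Finset.sum_congr rfl fun k _ => ?_
      rw [map_mul, hl, Algebra.smul_def, mul_assoc]
    refine ⟨∑ k, l k * v k, fun h0 => ?_, Or.inr ⟨l, fun B hB => hinj ?_, rfl⟩⟩
    · have := hlx v
      rw [h0, map_zero, eq_comm, mul_eq_zero, map_eq_zero_iff _ hinj] at this
      exact this.elim (nonZeroDivisors.coe_ne_zero q) hfu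
    · have h0 : f (w B) = 0 := by
        have : f (w B) ∈ Submodule.map f (Submodule.span F (w '' S)) :=
          Submodule.mem_map_of_mem (Submodule.subset_span ⟨B, hB, rfl⟩)
        rwa [hf, Submodule.mem_bot] at this
      rw [hlx, map_zero]
      exact mul_eq_zero_of_right _ h0

variable {n : ℕ}

/-- `A` is in the shifted family of `b` if and only if the row `A` of the compound matrix of `b`,
restricted to the columns in `Δ`, is not a combination of earlier rows of the same size. -/
theorem mem_shiftedFamily_iff {K : Type*} [Field K] (b : Matrix (Fin n) (Fin n) K)
    (Δ : LowerSet (Finset (Fin n))) (A : Finset (Fin n)) :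
    A ∈ shiftedFamily b Δ A.card ↔
      ¬ ∃ c : Finset (Fin n) → K, (∀ B, ¬ (B.card = A.card ∧ LexLT B A) → c B = 0) ∧
        ∀ F ∈ Δ, compoundEntry b A F = ∑ B, c B * compoundEntry b B F := by
  have hset : {y | ∃ B : Finset (Fin n), B.card = A.card ∧ LexLT B A ∧
        y = Submodule.Quotient.mk (p := faceIdeal K Δ) (wedge b B)} =
      (fun B => Submodule.Quotient.mk (p := faceIdeal K Δ) (wedge b B)) ''
        {B | B.card = A.card ∧ LexLT B A} := by
    ext y
    constructor
    · rintro ⟨B, h1, h2, rfl⟩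
      exact ⟨B, ⟨h1, h2⟩, rfl⟩
    · rintro ⟨B, ⟨h1, h2⟩, rfl⟩
      exact ⟨B, h1, h2, rfl⟩
  have hrel : ∀ c : Finset (Fin n) → K,
      (∑ B, c B • Submodule.Quotient.mk (p := faceIdeal K Δ) (wedge b B) =
        Submodule.Quotient.mk (p := faceIdeal K Δ) (wedge b A)) ↔
      ∀ F ∈ Δ, compoundEntry b A F = ∑ B, c B * compoundEntry b B F := by
    intro c
    have : ∑ B, c B • Submodule.Quotient.mk (p := faceIdeal K Δ) (wedge b B) =
        Submodule.Quotient.mk (p := faceIdeal K Δ) (∑ B, c B • wedge b B) := by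
      rw [← Submodule.mkQ_apply, map_sum]
      rfl
    rw [this, eq_comm, Submodule.Quotient.eq, mem_faceIdeal_iff]
    refine forall₂_congr fun F _ => ?_
    rw [map_sub, Finsupp.sub_apply, sub_eq_zero, repr_wedge]
    simp [repr_wedge]
  rw [shiftedFamily, Set.mem_ofPred_eq, and_iff_right rfl, not_iff_not, hset,
    Finsupp.mem_span_image_iff_linearCombination]
  constructor
  · rintro ⟨c, hc, h⟩
    refine ⟨c, fun B hB => ?_, (hrel c).1 ?_⟩
    · by_contra h0
      exact hB (hc (Finsupp.mem_support_iff.2 h0))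
    · rw [← h, Finsupp.linearCombination_apply, Finsupp.sum_fintype _ _ (by simp)]
  · rintro ⟨c, hc, h⟩
    refine ⟨Finsupp.equivFunOnFinite.symm c, fun B hB => ?_, ?_⟩
    · by_contra h0
      exact Finsupp.mem_support_iff.1 hB (hc B h0)
    · rw [Finsupp.linearCombination_apply, Finsupp.sum_fintype _ _ (by simp)]
      exact (hrel c).2 h

/-- For the matrix of indeterminates, a polynomial certificate decides whether `A` is in the shifted
family: up to a factor `q ≠ 0`, either the row `A` is a combination of earlier rows, or a linear
form separates it from them. -/
theorem exists_shiftedFamily_certificate (K : Type*) [Field K] (Δ : LowerSet (Finset (Fin n)))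
    (A : Finset (Fin n)) :
    ∃ q : MvPolynomial (Fin n × Fin n) K, q ≠ 0 ∧
      ((∃ c : Finset (Fin n) → MvPolynomial (Fin n × Fin n) K,
          (∀ B, ¬ (B.card = A.card ∧ LexLT B A) → c B = 0) ∧
          ∀ F ∈ Δ, q * compoundEntry (Matrix.mvPolynomialX (Fin n) (Fin n) K) A F =
            ∑ B, c B * compoundEntry (Matrix.mvPolynomialX (Fin n) (Fin n) K) B F) ∨
        ∃ l : Finset (Fin n) → MvPolynomial (Fin n × Fin n) K, (∀ F ∉ Δ, l F = 0) ∧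
          (∀ B, B.card = A.card → LexLT B A →
            ∑ F, l F * compoundEntry (Matrix.mvPolynomialX (Fin n) (Fin n) K) B F = 0) ∧
          ∑ F, l F * compoundEntry (Matrix.mvPolynomialX (Fin n) (Fin n) K) A F = q) := by
  classical
  set X := Matrix.mvPolynomialX (Fin n) (Fin n) K
  obtain ⟨q, hq, h⟩ := exists_span_certificate
    (fun B F => if F ∈ Δ then compoundEntry X B F else 0) {B | B.card = A.card ∧ LexLT B A}
    (fun F => if F ∈ Δ then compoundEntry X A F else 0)
  refine ⟨q, hq, h.imp ?_ ?_⟩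
  · rintro ⟨c, hc, h⟩
    refine ⟨c, hc, fun F hF => ?_⟩
    simpa [hF] using h F
  · rintro ⟨l, hl, h⟩
    refine ⟨fun F => if F ∈ Δ then l F else 0, fun F hF => if_neg hF, fun B h1 h2 => ?_, ?_⟩
    · refine (Finset.sum_congr rfl fun F _ => ?_).trans (hl B ⟨h1, h2⟩)
      by_cases hF : F ∈ Δ <;> simp [hF]
    · refine (Finset.sum_congr rfl fun F _ => ?_).trans h
      by_cases hF : F ∈ Δ <;> simp [hF]

theorem aeval_compoundEntry {K L : Type*} [Field K] [Field L] [Algebra K L]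
    (b : Matrix (Fin n) (Fin n) L) (A F : Finset (Fin n)) :
    MvPolynomial.aeval (fun p : Fin n × Fin n => b p.1 p.2)
      (compoundEntry (Matrix.mvPolynomialX (Fin n) (Fin n) K) A F) = compoundEntry b A F := by
  have := map_compoundEntry ((MvPolynomial.aeval (R := K) fun p : Fin n × Fin n => b p.1 p.2) :
    MvPolynomial (Fin n × Fin n) K →ₐ[K] L).toRingHom (Matrix.mvPolynomialX (Fin n) (Fin n) K) A F
  refine this.trans ?_
  congr 1
  ext i j
  simp

section Specialize

variable {K L : Type*} [Field K] [Field L] [Algebra K L] {Δ : LowerSet (Finset (Fin n))}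
  {A : Finset (Fin n)} {q : MvPolynomial (Fin n × Fin n) K} (b : Matrix (Fin n) (Fin n) L)

/-- A certificate of dependence is valid at every matrix at which `q` does not vanish. -/
theorem notMem_shiftedFamily_of_relation
    (hb : MvPolynomial.aeval (fun p : Fin n × Fin n => b p.1 p.2) q ≠ 0)
    {c : Finset (Fin n) → MvPolynomial (Fin n × Fin n) K}
    (hc : ∀ B, ¬ (B.card = A.card ∧ LexLT B A) → c B = 0)
    (h : ∀ F ∈ Δ, q * compoundEntry (Matrix.mvPolynomialX (Fin n) (Fin n) K) A F =
      ∑ B, c B * compoundEntry (Matrix.mvPolynomialX (Fin n) (Fin n) K) B F) :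
    A ∉ shiftedFamily b Δ A.card := by
  rw [mem_shiftedFamily_iff, not_not]
  set φ : MvPolynomial (Fin n × Fin n) K →ₐ[K] L :=
    MvPolynomial.aeval (fun p : Fin n × Fin n => b p.1 p.2) with hφ
  refine ⟨fun B => (φ q)⁻¹ * φ (c B), fun B hB => by simp [hc B hB], fun F hF => ?_⟩
  have := congrArg φ (h F hF)
  simp only [map_mul, map_sum, hφ, aeval_compoundEntry] at this
  simp only [mul_assoc, ← Finset.mul_sum, hφ]
  rw [← this, inv_mul_cancel_left₀ hb]

/-- A certificate of independence is valid at every matrix at which `q` does not vanish. -/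
theorem mem_shiftedFamily_of_separating
    (hb : MvPolynomial.aeval (fun p : Fin n × Fin n => b p.1 p.2) q ≠ 0)
    {l : Finset (Fin n) → MvPolynomial (Fin n × Fin n) K} (hl : ∀ F ∉ Δ, l F = 0)
    (hl0 : ∀ B, B.card = A.card → LexLT B A →
      ∑ F, l F * compoundEntry (Matrix.mvPolynomialX (Fin n) (Fin n) K) B F = 0)
    (hlq : ∑ F, l F * compoundEntry (Matrix.mvPolynomialX (Fin n) (Fin n) K) A F = q) :
    A ∈ shiftedFamily b Δ A.card := by
  rw [mem_shiftedFamily_iff]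
  set φ : MvPolynomial (Fin n × Fin n) K →ₐ[K] L :=
    MvPolynomial.aeval (fun p : Fin n × Fin n => b p.1 p.2) with hφ
  rintro ⟨c, hc, h⟩
  apply hb
  rw [← hlq, map_sum]
  simp only [map_mul, hφ, aeval_compoundEntry]
  calc ∑ F, φ (l F) * compoundEntry b A F
      = ∑ F, φ (l F) * ∑ B, c B * compoundEntry b B F := by
        refine Finset.sum_congr rfl fun F _ => ?_
        by_cases hF : F ∈ Δ
        · rw [h F hF]
        · simp [hl F hF]
    _ = ∑ B, c B * ∑ F, φ (l F) * compoundEntry b B F := by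
        simp only [Finset.mul_sum]
        rw [Finset.sum_comm]
        exact Finset.sum_congr rfl fun B _ => Finset.sum_congr rfl fun F _ => by ring
    _ = 0 := by
        refine Finset.sum_eq_zero fun B _ => ?_
        by_cases hB : B.card = A.card ∧ LexLT B A
        · have := congrArg φ (hl0 B hB.1 hB.2)
          simp only [map_mul, map_sum, hφ, aeval_compoundEntry, map_zero] at this
          rw [this, mul_zero]
        · rw [hc B hB, zero_mul]

end Specialize

/-- At a generic matrix over `K` the shifted families agree with those of a matrix whose entries
are algebraically independent over `K`. -/
theorem exists_generic_shiftedFamily {K L : Type*} [Field K] [Field L] [Algebra K L]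
    (Δ : LowerSet (Finset (Fin n))) (a : Matrix (Fin n) (Fin n) L)
    (ha : AlgebraicIndependent K (fun p : Fin n × Fin n => a p.1 p.2)) :
    ∃ P : MvPolynomial (Fin n × Fin n) K, P ≠ 0 ∧ ∀ b : Matrix (Fin n) (Fin n) K,
      MvPolynomial.eval (fun p : Fin n × Fin n => b p.1 p.2) P ≠ 0 →
      ∀ A, A ∈ shiftedFamily b Δ A.card ↔ A ∈ shiftedFamily a Δ A.card := by
  choose q hq h using exists_shiftedFamily_certificate K Δ
  refine ⟨∏ A, q A, Finset.prod_ne_zero_iff.2 fun A _ => hq A, fun b hb A => ?_⟩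
  have hbA : MvPolynomial.aeval (fun p : Fin n × Fin n => b p.1 p.2) (q A) ≠ 0 := by
    rw [map_prod, Finset.prod_ne_zero_iff] at hb
    exact hb A (Finset.mem_univ A)
  have haA : MvPolynomial.aeval (fun p : Fin n × Fin n => a p.1 p.2) (q A) ≠ 0 := fun h0 =>
    hq A (ha (h0.trans (map_zero _).symm))
  rcases h A with ⟨c, hc, hcq⟩ | ⟨l, hl, hl0, hlq⟩
  · exact iff_of_false (notMem_shiftedFamily_of_relation b hbA hc hcq)
      (notMem_shiftedFamily_of_relation a haA hc hcq)
  · exact iff_of_true (mem_shiftedFamily_of_separating b hbA hl hl0 hlq)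
      (mem_shiftedFamily_of_separating a haA hl hl0 hlq)

end Generic

/-! ### Initial ideals and the generic initial ideal -/

section Initial

variable {K : Type*} [Field K] {n : ℕ}

theorem linAut_linAut_inv (g : Matrix.GeneralLinearGroup (Fin n) K) (x : Ext K n) :
    linAut g (linAut g⁻¹ x) = x := by
  have h := ExteriorAlgebra.map_comp_map
    (Matrix.toLin' ((g⁻¹ : Matrix.GeneralLinearGroup (Fin n) K) : Matrix (Fin n) (Fin n) K))
    (Matrix.toLin' (g : Matrix (Fin n) (Fin n) K))
  rw [← Matrix.toLin'_mul, ← Units.val_mul, mul_inv_cancel, Units.val_one, Matrix.toLin'_one,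
    ExteriorAlgebra.map_id] at h
  exact DFunLike.congr_fun h x

theorem mem_map_linAut_iff {g : Matrix.GeneralLinearGroup (Fin n) K} {J : Ideal (Ext K n)}
    {f : Ext K n} : f ∈ J.map (linAut g) ↔ linAut g⁻¹ f ∈ J := by
  constructor
  · have : J.map (linAut g) ≤ J.comap (linAut g⁻¹) := by
      refine Ideal.map_le_iff_le_comap.2 fun x hx => ?_
      have := linAut_linAut_inv g⁻¹ x
      rw [inv_inv] at this
      rwa [Ideal.mem_comap, Ideal.mem_comap, this]
    exact fun h => this h
  · intro h
    have := Ideal.mem_map_of_mem (linAut g) h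
    rwa [linAut_linAut_inv] at this

theorem linAut_mono (g : Matrix.GeneralLinearGroup (Fin n) K) (A : Finset (Fin n)) :
    linAut g (mono K A) = wedge (g : Matrix (Fin n) (Fin n) K).transpose A := by
  unfold linAut mono wedge
  rw [ExteriorAlgebra.map_apply_ιMulti]
  congr 1
  ext k l
  simp [stdBasis]

theorem repr_linAut (g : Matrix.GeneralLinearGroup (Fin n) K) (f : Ext K n)
    (F : Finset (Fin n)) : (monoBasis K n).repr (linAut g f) F =
      ∑ B, (monoBasis K n).repr f B *
        compoundEntry (g : Matrix (Fin n) (Fin n) K).transpose B F := by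
  conv_lhs => rw [← (monoBasis K n).sum_repr f]
  simp [monoBasis_apply, linAut_mono, repr_wedge]

/-- The monomial `e_A` is standard for `g(J_Δ)` if and only if `A` is in the shifted family
computed with the transposed inverse of `g`. -/
theorem mem_shiftedFamily_iff_not_initial (g : Matrix.GeneralLinearGroup (Fin n) K)
    (Δ : LowerSet (Finset (Fin n))) (A : Finset (Fin n)) :
    A ∈ shiftedFamily (((g⁻¹ : Matrix.GeneralLinearGroup (Fin n) K) :
        Matrix (Fin n) (Fin n) K).transpose) Δ A.card ↔
      ¬ ∃ f ∈ (faceIdeal K Δ).map (linAut g), IsInitialMonomial f A := by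
  classical
  set b := ((g⁻¹ : Matrix.GeneralLinearGroup (Fin n) K) : Matrix (Fin n) (Fin n) K).transpose
  rw [mem_shiftedFamily_iff, not_iff_not]
  have hirr : ¬ LexLT A A := by
    rintro ⟨a, ha, -⟩
    simp at ha
  simp only [mem_map_linAut_iff, mem_faceIdeal_iff, repr_linAut]
  constructor
  · rintro ⟨c, hc, h⟩
    have hcA : c A = 0 := hc A fun h => hirr h.2
    refine ⟨(monoBasis K n).equivFun.symm (Pi.single A 1 - c), fun F hF => ?_, ?_,
      fun B hB hBA => ?_⟩
    · have : ∀ B, (monoBasis K n).repr ((monoBasis K n).equivFun.symm (Pi.single A 1 - c)) B =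
          (Pi.single A 1 - c : Finset (Fin n) → K) B := fun B => by
        rw [← Basis.equivFun_apply, LinearEquiv.apply_symm_apply]
      simp only [this, Pi.sub_apply, sub_mul, Finset.sum_sub_distrib]
      rw [← h F hF, sub_eq_zero, Finset.sum_eq_single A]
      · simp [b]
      · intro B _ hB
        simp [hB]
      · simp
    · rw [← Basis.equivFun_apply, LinearEquiv.apply_symm_apply]
      simp [hcA]
    · rw [← Basis.equivFun_apply, LinearEquiv.apply_symm_apply, Pi.sub_apply,
        Pi.single_eq_of_ne hBA, zero_sub, neg_ne_zero] at hB
      by_contra hlt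
      exact hB (hc B fun h => hlt (Or.inr h))
  · rintro ⟨f, hf, hA, hlt⟩
    set r := (monoBasis K n).repr f
    -- `f` need not be homogeneous, but its component of degree `|A|` satisfies the same equations,
    -- as compound matrix entries between different sizes vanish
    refine ⟨fun B => if B.card = A.card ∧ LexLT B A then -((r A)⁻¹ * r B) else 0,
      fun B hB => if_neg hB, fun F hF => ?_⟩
    by_cases hFA : F.card = A.card
    · have h0 := hf F hF
      rw [← Finset.add_sum_erase _ _ (Finset.mem_univ A)] at h0
      have h1 : ∑ B, (if B.card = A.card ∧ LexLT B A then -((r A)⁻¹ * r B) else 0) *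
          compoundEntry b B F =
          -(r A)⁻¹ * ∑ B ∈ Finset.univ.erase A, r B * compoundEntry b B F := by
        rw [Finset.mul_sum, ← Finset.add_sum_erase _ _ (Finset.mem_univ A),
          if_neg fun h => hirr h.2, zero_mul, zero_add]
        refine Finset.sum_congr rfl fun B hB => ?_
        by_cases hBA : B.card = A.card ∧ LexLT B A
        · rw [if_pos hBA]
          ring
        · rw [if_neg hBA]
          by_cases hrB : r B = 0
          · simp [hrB]
          · have hlt' := (hlt B hrB (Finset.ne_of_mem_erase hB)).resolve_right hBA
            rw [compoundEntry_of_card_ne b (hFA.trans_ne hlt'.ne')]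
            simp
      rw [h1, eq_neg_of_add_eq_zero_right h0]
      field_simp
      rfl
    · rw [compoundEntry_of_card_ne b hFA, eq_comm]
      refine Finset.sum_eq_zero fun B _ => ?_
      by_cases hBA : B.card = A.card ∧ LexLT B A
      · rw [compoundEntry_of_card_ne b (hBA.1 ▸ hFA), mul_zero]
      · simp [hBA]

theorem RevLexLT.insert {A B : Finset (Fin n)} (h : RevLexLT B A) {i : Fin n} (hB : i ∉ B)
    (hA : i ∉ A) : RevLexLT (insert i B) (insert i A) := by
  have hs : symmDiff (Insert.insert i B) (Insert.insert i A) = symmDiff B A := by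
    ext x
    by_cases hx : x = i
    · subst hx
      simp [Finset.mem_symmDiff, hA, hB]
    · simp [Finset.mem_symmDiff, hx]
  refine h.imp (fun h => ?_) (fun h => ⟨?_, ?_⟩)
  · rw [Finset.card_insert_of_notMem hA, Finset.card_insert_of_notMem hB]
    omega
  · rw [Finset.card_insert_of_notMem hA, Finset.card_insert_of_notMem hB, h.1]
  · obtain ⟨a, ha, hmin, haB⟩ := h.2
    exact ⟨a, hs ▸ ha, hs ▸ hmin, Finset.mem_insert_of_mem haB⟩

theorem IsInitialMonomial.insert {f : Ext K n} {A : Finset (Fin n)} (h : IsInitialMonomial f A)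
    {i : Fin n} (hi : i ∉ A) : IsInitialMonomial (mono K {i} * f) (insert i A) := by
  constructor
  · obtain ⟨ε, hε, H⟩ := exists_repr_mono_singleton_mul (K := K) (Finset.mem_insert_self i A)
    rw [H, Finset.erase_insert hi]
    exact mul_ne_zero hε h.1
  · intro C hC hCA
    have hiC : i ∈ C := by
      by_contra hiC
      exact hC (repr_mono_singleton_mul_of_notMem hiC f)
    obtain ⟨ε, hε, H⟩ := exists_repr_mono_singleton_mul (K := K) hiC
    rw [H] at hC
    have := h.2 (C.erase i) (right_ne_zero_of_mul hC) (by
      rintro rfl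
      exact hCA (Finset.insert_erase hiC).symm)
    simpa [Finset.insert_erase hiC] using this.insert (Finset.notMem_erase i C) hi

/-- The monomials that are not initial monomials of elements of an ideal form a simplicial
complex. -/
def standardComplex (J : Ideal (Ext K n)) : LowerSet (Finset (Fin n)) where
  carrier := {A | ¬ ∃ f ∈ J, IsInitialMonomial f A}
  lower' := by
    rintro B A hAB hB ⟨f, hf, hA⟩
    obtain ⟨D, rfl, hd⟩ : ∃ D, B = A ∪ D ∧ Disjoint A D :=
      ⟨B \ A, (Finset.union_sdiff_of_subset hAB).symm, Finset.disjoint_sdiff⟩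
    apply hB
    clear hB hAB
    induction D using Finset.induction_on with
    | empty => exact ⟨f, hf, by simpa using hA⟩
    | insert i D hi ih =>
      rw [Finset.disjoint_insert_right] at hd
      obtain ⟨f', hf', hA'⟩ := ih hd.2
      refine ⟨mono K {i} * f', J.mul_mem_left _ hf', ?_⟩
      rw [Finset.union_insert]
      exact hA'.insert (by simp [hi, hd.1])

theorem mem_standardComplex {J : Ideal (Ext K n)} {A : Finset (Fin n)} :
    A ∈ standardComplex J ↔ ¬ ∃ f ∈ J, IsInitialMonomial f A :=
  Iff.rfl

theorem initialIdeal_eq_faceIdeal (J : Ideal (Ext K n)) :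
    initialIdeal J = faceIdeal K (standardComplex J) := by
  unfold initialIdeal faceIdeal
  congr 1
  ext m
  simp only [mem_standardComplex, not_not, Set.mem_ofPred_eq]
  constructor
  · rintro ⟨f, hf, A, hA, rfl⟩
    exact ⟨A, ⟨f, hf, hA⟩, rfl⟩
  · rintro ⟨A, ⟨f, hf, hA⟩, rfl⟩
    exact ⟨f, hf, A, hA, rfl⟩

/-- A polynomial function of the transposed inverse of `g` becomes a polynomial function of `g`
after multiplication by a power of the determinant. -/
theorem exists_eval_transpose_inv (P : MvPolynomial (Fin n × Fin n) K) :
    ∃ (N : ℕ) (Q : MvPolynomial (Fin n × Fin n) K),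
      ∀ g : Matrix.GeneralLinearGroup (Fin n) K,
        MvPolynomial.eval (fun p => (g : Matrix (Fin n) (Fin n) K) p.1 p.2) Q =
          (g : Matrix (Fin n) (Fin n) K).det ^ N *
            MvPolynomial.eval (fun p => ((g⁻¹ : Matrix.GeneralLinearGroup (Fin n) K) :
              Matrix (Fin n) (Fin n) K).transpose p.1 p.2) P := by
  set X := Matrix.mvPolynomialX (Fin n) (Fin n) K
  have hX : ∀ g : Matrix (Fin n) (Fin n) K,
      X.map (MvPolynomial.eval fun p => g p.1 p.2) = g := fun g => by
    ext i j
    simp [X]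
  have hdet : ∀ g : Matrix (Fin n) (Fin n) K,
      MvPolynomial.eval (fun p => g p.1 p.2) X.det = g.det := fun g => by
    rw [RingHom.map_det, RingHom.mapMatrix_apply, hX]
  have hadj : ∀ (g : Matrix (Fin n) (Fin n) K) i j,
      MvPolynomial.eval (fun p => g p.1 p.2) (X.adjugate i j) = g.adjugate i j := fun g i j => by
    have := RingHom.map_adjugate (MvPolynomial.eval fun p => g p.1 p.2) X
    rw [RingHom.mapMatrix_apply, RingHom.mapMatrix_apply, hX] at this
    rw [← this, Matrix.map_apply]
  induction P using MvPolynomial.induction_on with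
  | C r => exact ⟨0, MvPolynomial.C r, fun g => by simp⟩
  | add P₁ P₂ h₁ h₂ =>
    obtain ⟨N₁, Q₁, h₁⟩ := h₁
    obtain ⟨N₂, Q₂, h₂⟩ := h₂
    refine ⟨N₁ + N₂, Q₁ * X.det ^ N₂ + Q₂ * X.det ^ N₁, fun g => ?_⟩
    simp only [map_add, map_mul, map_pow, h₁, h₂, hdet]
    ring
  | mul_X P p h =>
    obtain ⟨N, Q, h⟩ := h
    refine ⟨N + 1, Q * X.adjugate p.2 p.1, fun g => ?_⟩
    have hu : (g : Matrix (Fin n) (Fin n) K).det ≠ 0 :=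
      ((Matrix.isUnit_iff_isUnit_det _).1 g.isUnit).ne_zero
    have : ((g⁻¹ : Matrix.GeneralLinearGroup (Fin n) K) : Matrix (Fin n) (Fin n) K) =
        (g : Matrix (Fin n) (Fin n) K).det⁻¹ • (g : Matrix (Fin n) (Fin n) K).adjugate := by
      rw [Matrix.coe_units_inv, Matrix.inv_def, Ring.inverse_eq_inv']
    simp only [map_mul, h, hadj, MvPolynomial.eval_X, Matrix.transpose_apply, pow_succ]
    rw [this, Matrix.smul_apply, smul_eq_mul]
    field_simp

variable [Infinite K]

theorem exists_generalLinearGroup_eval_ne_zero {P : MvPolynomial (Fin n × Fin n) K} (hP : P ≠ 0) :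
    ∃ g : Matrix.GeneralLinearGroup (Fin n) K,
      MvPolynomial.eval (fun p => (g : Matrix (Fin n) (Fin n) K) p.1 p.2) P ≠ 0 := by
  have hne : P * (Matrix.mvPolynomialX (Fin n) (Fin n) K).det ≠ 0 :=
    mul_ne_zero hP (Matrix.det_mvPolynomialX_ne_zero _ _)
  obtain ⟨x, hx⟩ : ∃ x,
      MvPolynomial.eval x (P * (Matrix.mvPolynomialX (Fin n) (Fin n) K).det) ≠ 0 := by
    by_contra! h
    exact hne (MvPolynomial.funext fun x => by simpa using h x)
  have hM : (Matrix.mvPolynomialX (Fin n) (Fin n) K).map (MvPolynomial.eval x) =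
      Matrix.of fun i j => x (i, j) := by
    ext i j
    simp
  rw [map_mul, RingHom.map_det, RingHom.mapMatrix_apply, hM] at hx
  exact ⟨Matrix.GeneralLinearGroup.mkOfDetNeZero _ (right_ne_zero_of_mul hx),
    left_ne_zero_of_mul hx⟩

theorem IsZariskiOpen.inter_nonempty {U V : Set (Matrix.GeneralLinearGroup (Fin n) K)}
    (hU : IsZariskiOpen U) (hV : IsZariskiOpen V) (hU' : U.Nonempty) (hV' : V.Nonempty) :
    (U ∩ V).Nonempty := by
  obtain ⟨S, hS⟩ := hU
  obtain ⟨T, hT⟩ := hV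
  obtain ⟨g, hg⟩ := hU'
  obtain ⟨h, hh⟩ := hV'
  obtain ⟨p, hp, hpg⟩ := (hS g).1 hg
  obtain ⟨q, hq, hqh⟩ := (hT h).1 hh
  have hpq : p * q ≠ 0 := mul_ne_zero (fun h0 => hpg (by simp [h0])) fun h0 => hqh (by simp [h0])
  obtain ⟨k, hk⟩ := exists_generalLinearGroup_eval_ne_zero hpq
  rw [map_mul] at hk
  exact ⟨k, (hS k).2 ⟨p, hp, left_ne_zero_of_mul hk⟩, (hT k).2 ⟨q, hq, right_ne_zero_of_mul hk⟩⟩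

/-- Generic initial ideals are unique over an infinite field, where non-empty open sets meet. -/
theorem IsGin.unique {J I I' : Ideal (Ext K n)} (h : IsGin J I) (h' : IsGin J I') : I = I' := by
  obtain ⟨U, hne, hU, hI⟩ := h
  obtain ⟨V, hne', hV, hI'⟩ := h'
  obtain ⟨g, hgU, hgV⟩ := hU.inter_nonempty hV hne hne'
  rw [← hI g hgU, hI' g hgV]

/-- The size bound in the definition of the exterior shifting is automatic: `f_A ∈ J_Δ` if `A` is
larger than every face. -/
theorem mem_exteriorShifting_iff {L : Type*} [Field L] (a : Matrix (Fin n) (Fin n) L)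
    (Δ : LowerSet (Finset (Fin n))) (A : Finset (Fin n)) :
    A ∈ exteriorShifting a Δ ↔ A ∈ shiftedFamily a Δ A.card := by
  constructor
  · rintro ⟨r, -, hA⟩
    obtain rfl := hA.1
    exact hA
  · intro hA
    refine ⟨A.card, ?_, hA⟩
    rw [mem_shiftedFamily_iff] at hA
    by_contra! hG
    refine hA ⟨0, fun _ _ => rfl, fun F hF => ?_⟩
    rw [compoundEntry_of_card_ne a (hG F hF).ne]
    simp

/-- The exterior face ideal of the exterior shifting is a generic initial ideal of the exterior
face ideal. -/
theorem exists_isGin_faceIdeal {L : Type*} [Field L] [Algebra K L]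
    (Δ : LowerSet (Finset (Fin n))) (a : Matrix (Fin n) (Fin n) L)
    (ha : AlgebraicIndependent K (fun p : Fin n × Fin n => a p.1 p.2)) :
    ∃ Γ : LowerSet (Finset (Fin n)), (Γ : Set (Finset (Fin n))) = exteriorShifting a Δ ∧
      IsGin (faceIdeal K Δ) (faceIdeal K Γ) := by
  obtain ⟨P, hP, hPa⟩ := exists_generic_shiftedFamily Δ a ha
  obtain ⟨N, Q, hQ⟩ := exists_eval_transpose_inv P
  set U : Set (Matrix.GeneralLinearGroup (Fin n) K) :=
    {g | MvPolynomial.eval (fun p => (g : Matrix (Fin n) (Fin n) K) p.1 p.2) Q ≠ 0}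
  have hstd : ∀ g ∈ U, (standardComplex ((faceIdeal K Δ).map (linAut g)) : Set (Finset (Fin n))) =
      exteriorShifting a Δ := fun g hg => by
    ext A
    rw [mem_exteriorShifting_iff, SetLike.mem_coe, mem_standardComplex,
      ← mem_shiftedFamily_iff_not_initial]
    refine hPa _ ?_ A
    have : MvPolynomial.eval (fun p => (g : Matrix (Fin n) (Fin n) K) p.1 p.2) Q ≠ 0 := hg
    rw [hQ] at this
    exact right_ne_zero_of_mul this
  have hne : U.Nonempty := by
    obtain ⟨g, hg⟩ := exists_generalLinearGroup_eval_ne_zero hP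
    -- the witness is `h` with `(h⁻¹)ᵀ = g`
    have hdet : (g : Matrix (Fin n) (Fin n) K).transpose.det ≠ 0 := by
      rw [Matrix.det_transpose]
      exact ((Matrix.isUnit_iff_isUnit_det _).1 g.isUnit).ne_zero
    refine ⟨(Matrix.GeneralLinearGroup.mkOfDetNeZero _ hdet)⁻¹, ?_⟩
    change MvPolynomial.eval _ Q ≠ 0
    rw [hQ, inv_inv]
    exact mul_ne_zero (pow_ne_zero _ ((Matrix.isUnit_iff_isUnit_det _).1 (Units.isUnit _)).ne_zero)
      hg
  obtain ⟨g₀, hg₀⟩ := hne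
  refine ⟨standardComplex ((faceIdeal K Δ).map (linAut g₀)), hstd g₀ hg₀, U, ⟨g₀, hg₀⟩,
    ⟨{Q}, fun g => by simp [U]⟩, fun g hg => ?_⟩
  rw [initialIdeal_eq_faceIdeal]
  congr 1
  exact SetLike.coe_injective ((hstd g hg).trans (hstd g₀ hg₀).symm)

end Initial

/-! ### Cohomology of multiplication by a variable -/

section Cohomology

variable {K : Type*} [Field K] {n : ℕ} {N : Type*} [AddCommGroup N] [Module K N]
  [Module (Ext K n) N] [IsScalarTower K (Ext K n) N]

/-- A quotient of `E` by `J_Δ` has the classes of the faces of `Δ` as a basis. It is presented as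
the target of a surjection, since it arises below as an iterated quotient. -/
theorem exists_basis_of_ker_eq_faceIdeal {Δ : LowerSet (Finset (Fin n))}
    (ρ : Ext K n →ₗ[Ext K n] N) (hρ : Function.Surjective ρ)
    (hker : LinearMap.ker ρ = faceIdeal K Δ) :
    ∃ β : Basis {F // F ∈ Δ} K N, (∀ F, β F = ρ (mono K F)) ∧
      ∀ f F, β.repr (ρ f) F = (monoBasis K n).repr f F := by
  classical
  let ρK : Ext K n →ₗ[K] N := ρ.restrictScalars K
  let θ : Ext K n →ₗ[K] ({F // F ∈ Δ} →₀ K) :=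
    Finsupp.lcomapDomain Subtype.val Subtype.val_injective ∘ₗ (monoBasis K n).repr.toLinearMap
  have hθ : ∀ f F, θ f F = (monoBasis K n).repr f F := fun f F => rfl
  have hθs : Function.Surjective θ := fun c => by
    refine ⟨(monoBasis K n).repr.symm (c.embDomain (Function.Embedding.subtype _)), ?_⟩
    ext F
    rw [hθ, LinearEquiv.apply_symm_apply]
    exact Finsupp.embDomain_apply_self (Function.Embedding.subtype _) c F
  have hk : LinearMap.ker ρK = LinearMap.ker θ := by
    ext f
    have : f ∈ LinearMap.ker ρ ↔ f ∈ faceIdeal K Δ := by rw [hker]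
    rw [mem_faceIdeal_iff] at this
    refine Iff.trans this ?_
    rw [LinearMap.mem_ker, Finsupp.ext_iff]
    simp [hθ]
  let e : N ≃ₗ[K] ({F // F ∈ Δ} →₀ K) :=
    (LinearMap.quotKerEquivOfSurjective ρK hρ).symm ≪≫ₗ
      Submodule.quotEquivOfEq _ _ hk ≪≫ₗ LinearMap.quotKerEquivOfSurjective θ hθs
  have he : ∀ f, e (ρ f) = θ f := fun f => by
    have : (LinearMap.quotKerEquivOfSurjective ρK hρ).symm (ρ f) = Submodule.Quotient.mk f := by
      rw [LinearEquiv.symm_apply_eq]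
      rfl
    simp only [e, LinearEquiv.trans_apply, this]
    rfl
  refine ⟨Basis.ofRepr e, fun F => ?_, fun f F => ?_⟩
  · rw [Basis.coe_ofRepr, LinearEquiv.symm_apply_eq, he]
    ext G
    rw [hθ, ← monoBasis_apply, Basis.repr_self]
    by_cases h : G = F
    · subst h
      rw [Finsupp.single_eq_same, Finsupp.single_eq_same]
    · rw [Finsupp.single_eq_of_ne h, Finsupp.single_eq_of_ne fun h' => h (Subtype.ext h')]
  · change e (ρ f) F = _
    rw [he, hθ]

theorem finrank_quotient_submoduleOf {V : Type*} [AddCommGroup V] [Module K V]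
    [FiniteDimensional K V] {B Z : Submodule K V} (h : B ≤ Z) :
    finrank K (Z ⧸ B.submoduleOf Z) = finrank K Z - finrank K B := by
  have h1 := Submodule.finrank_quotient_add_finrank (B.submoduleOf Z)
  rw [(Submodule.submoduleOfEquivOfLe h).finrank_eq] at h1
  omega

theorem finrank_span_basis_image {V ι : Type*} [AddCommGroup V] [Module K V] [Finite ι]
    (β : Basis ι K V) (S : Set ι) : finrank K (Submodule.span K (β '' S)) = S.ncard := by
  classical
  have := Fintype.ofFinite ι
  have : Fintype S := Fintype.ofFinite S
  have h := finrank_span_eq_card (R := K) (b := fun s : S => β s)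
    (β.linearIndependent.comp _ Subtype.val_injective)
  rw [← Nat.card_coe_set_eq, Nat.card_eq_fintype_card, ← h, Set.image_eq_range]

theorem mem_span_basis_image_iff {V ι : Type*} [AddCommGroup V] [Module K V]
    (β : Basis ι K V) (S : Set ι) (x : V) :
    x ∈ Submodule.span K (β '' S) ↔ ∀ F ∉ S, β.repr x F = 0 := by
  rw [Basis.mem_span_image]
  refine forall_congr' fun F => ?_
  rw [Finset.mem_coe, Finsupp.mem_support_iff, not_imp_comm]

theorem map_extPiece_eq_span {Δ : LowerSet (Finset (Fin n))} (ρ : Ext K n →ₗ[Ext K n] N)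
    (hker : LinearMap.ker ρ = faceIdeal K Δ) (β : Basis {F // F ∈ Δ} K N)
    (hβ : ∀ F, β F = ρ (mono K F)) (j : ℤ) :
    (extPiece K n j).map (ρ.restrictScalars K) =
      Submodule.span K (β '' {F | (F.1.card : ℤ) = j}) := by
  rw [extPiece_eq_span, Submodule.map_span]
  refine le_antisymm (Submodule.span_le.2 ?_) (Submodule.span_mono ?_)
  · rintro _ ⟨_, ⟨F, hF, rfl⟩, rfl⟩
    by_cases hFΔ : F ∈ Δ
    · exact Submodule.subset_span ⟨⟨F, hFΔ⟩, hF, by simp [hβ, monoBasis_apply]⟩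
    · have : monoBasis K n F ∈ LinearMap.ker ρ := by
        rw [hker, monoBasis_apply]
        exact Ideal.subset_span ⟨F, hFΔ, rfl⟩
      simp [LinearMap.mem_ker.1 this]
  · rintro _ ⟨F, hF, rfl⟩
    exact ⟨_, ⟨F.1, hF, rfl⟩, by simp [hβ, monoBasis_apply]⟩

/-- The cohomology of multiplication by `e_i` on `K{Δ}`: cycles are spanned by the faces `F` with
`i ∈ F` or `F ∪ {i} ∉ Δ`, boundaries by the faces containing `i`. -/
theorem cohomDim_of_ker_eq_faceIdeal {Δ : LowerSet (Finset (Fin n))}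
    (ρ : Ext K n →ₗ[Ext K n] N) (hρ : Function.Surjective ρ)
    (hker : LinearMap.ker ρ = faceIdeal K Δ) (𝓝 : ℤ → Submodule K N)
    (h𝓝 : ∀ j, 𝓝 j = (extPiece K n j).map (ρ.restrictScalars K)) (i : Fin n) (j : ℤ) :
    cohomDim 𝓝 (linForm (stdBasis K n i)) j =
      Set.ncard {F | F ∈ Δ ∧ (F.card : ℤ) = j ∧ i ∉ F ∧ insert i F ∉ Δ} := by
  obtain ⟨β, hβ, hrepr⟩ := exists_basis_of_ker_eq_faceIdeal ρ hρ hker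
  have hfin : FiniteDimensional K N := β.finiteDimensional_of_finite
  rw [← mono_singleton]
  set d := Algebra.lsmul K K N (mono K {i})
  have hdρ : ∀ f, d (ρ f) = ρ (mono K {i} * f) := fun f => by
    rw [← smul_eq_mul, map_smul]
    rfl
  have hpiece : ∀ j, 𝓝 j = Submodule.span K (β '' {F | (F.1.card : ℤ) = j}) := fun j => by
    rw [h𝓝, map_extPiece_eq_span ρ hker β hβ]
  have hd_mem : ∀ C : {F // F ∈ Δ}, i ∈ C.1 → ∃ ε : K, ε ≠ 0 ∧ ∀ x, β.repr (d x) C =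
      ε * β.repr x ⟨C.1.erase i, Δ.lower (Finset.erase_subset _ _) C.2⟩ := by
    intro C hC
    obtain ⟨ε, hε, H⟩ := exists_repr_mono_singleton_mul (K := K) hC
    refine ⟨ε, hε, fun x => ?_⟩
    obtain ⟨f, rfl⟩ := hρ x
    rw [hdρ, hrepr, hrepr, H]
  have hd_notMem : ∀ C : {F // F ∈ Δ}, i ∉ C.1 → ∀ x, β.repr (d x) C = 0 := by
    intro C hC x
    obtain ⟨f, rfl⟩ := hρ x
    rw [hdρ, hrepr, repr_mono_singleton_mul_of_notMem hC]
  have hZ : 𝓝 j ⊓ LinearMap.ker d = Submodule.span K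
      (β '' {F | (F.1.card : ℤ) = j ∧ (i ∈ F.1 ∨ insert i F.1 ∉ Δ)}) := by
    ext x
    rw [Submodule.mem_inf, hpiece, mem_span_basis_image_iff, mem_span_basis_image_iff,
      LinearMap.mem_ker]
    constructor
    · rintro ⟨h1, h2⟩ F hF
      by_cases hj : (F.1.card : ℤ) = j
      · obtain ⟨hi, hiF⟩ : i ∉ F.1 ∧ insert i F.1 ∈ Δ := by
          simpa [hj] using hF
        obtain ⟨ε, hε, H⟩ := hd_mem ⟨insert i F.1, hiF⟩ (Finset.mem_insert_self i F.1)
        have := H x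
        simp only [h2, map_zero, Finsupp.coe_zero, Pi.zero_apply, Finset.erase_insert hi] at this
        exact (mul_eq_zero.1 this.symm).resolve_left hε
      · exact h1 F hj
    · intro h
      refine ⟨fun F hF => h F fun hF' => hF hF'.1, ?_⟩
      rw [← β.repr.map_eq_zero_iff]
      ext C
      by_cases hC : i ∈ C.1
      · obtain ⟨ε, hε, H⟩ := hd_mem C hC
        rw [H, h, mul_zero, Finsupp.zero_apply]
        rintro ⟨-, h' | h'⟩
        · exact Finset.notMem_erase i C.1 h'
        · exact h' (by simp [Finset.insert_erase hC])
      · rw [hd_notMem C hC, Finsupp.zero_apply]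
  have hB : (𝓝 (j - 1)).map d = Submodule.span K
      (β '' {F | (F.1.card : ℤ) = j ∧ i ∈ F.1}) := by
    apply le_antisymm
    · rintro _ ⟨x, hx, rfl⟩
      rw [SetLike.mem_coe, hpiece, mem_span_basis_image_iff] at hx
      rw [mem_span_basis_image_iff]
      intro C hC
      by_cases hiC : i ∈ C.1
      · obtain ⟨ε, hε, H⟩ := hd_mem C hiC
        rw [H, hx, mul_zero]
        intro h
        apply hC
        refine ⟨?_, hiC⟩
        have h1 : ((C.1.erase i).card : ℤ) = j - 1 := h
        have := Finset.card_erase_add_one hiC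
        omega
      · exact hd_notMem C hiC x
    · rw [Submodule.span_le]
      rintro _ ⟨C, ⟨hj, hiC⟩, rfl⟩
      obtain ⟨ε, hε, H⟩ := exists_mono_eq_mul (K := K) hiC
      refine ⟨ε⁻¹ • ρ (mono K (C.1.erase i)), Submodule.smul_mem _ _ ?_, ?_⟩
      · rw [h𝓝]
        refine ⟨mono K (C.1.erase i), ?_, rfl⟩
        rw [SetLike.mem_coe, extPiece_eq_span, ← monoBasis_apply]
        refine Submodule.subset_span ⟨_, ?_, rfl⟩
        have := Finset.card_erase_add_one hiC
        change ((C.1.erase i).card : ℤ) = j - 1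
        omega
      · rw [map_smul, hdρ, H, hβ]
        change ε⁻¹ • (ρ.restrictScalars K) (ε • mono K C.1) = _
        rw [map_smul, inv_smul_smul₀ hε]
        rfl
  have hsub : {F : {F // F ∈ Δ} | (F.1.card : ℤ) = j ∧ i ∈ F.1} ⊆
      {F | (F.1.card : ℤ) = j ∧ (i ∈ F.1 ∨ insert i F.1 ∉ Δ)} :=
    fun F hF => ⟨hF.1, Or.inl hF.2⟩
  have hBZ : (𝓝 (j - 1)).map d ≤ 𝓝 j ⊓ LinearMap.ker d := by
    rw [hB, hZ]
    exact Submodule.span_mono (Set.image_mono hsub)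
  rw [cohomDim, finrank_quotient_submoduleOf hBZ, hB, hZ, finrank_span_basis_image,
    finrank_span_basis_image, ← Set.ncard_sdiff hsub,
    ← Set.ncard_image_of_injective _ Subtype.val_injective]
  congr 1
  ext F
  constructor
  · rintro ⟨F, ⟨⟨hj, h⟩, h'⟩, rfl⟩
    have hi : i ∉ F.1 := fun hi => h' ⟨hj, hi⟩
    exact ⟨F.2, hj, hi, h.resolve_left hi⟩
  · rintro ⟨hF, hj, hi, hiF⟩
    exact ⟨⟨F, hF⟩, ⟨⟨hj, Or.inr hiF⟩, fun h => hi h.2⟩, rfl⟩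

/-- The subcomplex of the faces that only have vertices `≥ i`. -/
def deleteBelow (Γ : LowerSet (Finset (Fin n))) (i : Fin n) : LowerSet (Finset (Fin n)) where
  carrier := {F | F ∈ Γ ∧ ∀ k ∈ F, i ≤ k}
  lower' := fun _ _ hGF hF => ⟨Γ.lower hGF hF.1, fun k hk => hF.2 k (hGF hk)⟩

/-- Passing from `K{Γ}` to its quotient by `e_k`, `k < i`, removes the faces with a vertex
below `i`. -/
theorem mk_mem_smul_top_iff (Γ : LowerSet (Finset (Fin n))) (i : Fin n) (f : Ext K n) :
    (faceIdeal K Γ).mkQ f ∈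
        (Ideal.span {x : Ext K n | ∃ k < i, x = linForm (stdBasis K n k)} •
          (⊤ : Submodule (Ext K n) (Ext K n ⧸ faceIdeal K Γ))) ↔
      f ∈ faceIdeal K (deleteBelow Γ i) := by
  set P := Ideal.span {x : Ext K n | ∃ k < i, x = linForm (stdBasis K n k)} •
    (⊤ : Submodule (Ext K n) (Ext K n ⧸ faceIdeal K Γ))
  constructor
  · have hle : P ≤ Submodule.map (faceIdeal K Γ).mkQ (faceIdeal K (deleteBelow Γ i)) := by
      refine Submodule.smul_le.2 fun x hx m _ => ?_
      obtain ⟨y, rfl⟩ := Submodule.mkQ_surjective _ m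
      rw [← map_smul]
      refine Submodule.mem_map_of_mem ?_
      refine Submodule.span_induction
        (p := fun x _ => x • y ∈ faceIdeal K (deleteBelow Γ i)) ?_ ?_ ?_ ?_ hx
      · rintro _ ⟨k, hk, rfl⟩
        rw [mem_faceIdeal_iff, ← mono_singleton]
        intro F hF
        exact repr_mono_singleton_mul_of_notMem (fun hkF => (hF.2 k hkF).not_gt hk) y
      · simp
      · intro a b _ _ ha hb
        rw [add_smul]
        exact add_mem ha hb
      · intro a b _ hb
        rw [smul_assoc]
        exact Submodule.smul_mem _ a hb
    intro hf
    obtain ⟨z, hz, hzf⟩ := hle hf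
    rw [Submodule.mkQ_apply, Submodule.mkQ_apply, Submodule.Quotient.eq, mem_faceIdeal_iff] at hzf
    rw [SetLike.mem_coe, mem_faceIdeal_iff] at hz
    rw [mem_faceIdeal_iff]
    intro F hF
    have := hzf F hF.1
    rw [map_sub, Finsupp.sub_apply, hz F hF, zero_sub, neg_eq_zero] at this
    exact this
  · suffices h : faceIdeal K (deleteBelow Γ i) ≤ P.comap (faceIdeal K Γ).mkQ from fun hf => h hf
    refine Submodule.span_le.2 ?_
    rintro _ ⟨F, hF, rfl⟩
    rw [SetLike.mem_coe, Submodule.mem_comap]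
    by_cases hFΓ : F ∈ Γ
    · obtain ⟨k, hkF, hk⟩ : ∃ k ∈ F, k < i := by
        by_contra! h
        exact hF ⟨hFΓ, h⟩
      obtain ⟨ε, hε, H⟩ := exists_mono_eq_mul (K := K) hkF
      have : mono K F = algebraMap K (Ext K n) ε⁻¹ • (mono K {k} • mono K (F.erase k)) := by
        rw [smul_eq_mul (mono K {k}), H, algebraMap_smul, inv_smul_smul₀ hε]
      rw [this, map_smul, map_smul]
      exact P.smul_mem _ (Submodule.smul_mem_smul
        (Ideal.subset_span ⟨k, hk, mono_singleton k⟩) Submodule.mem_top)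
    · have : (faceIdeal K Γ).mkQ (mono K F) = 0 :=
        (Submodule.Quotient.mk_eq_zero _).2 (Ideal.subset_span ⟨F, hFΓ, rfl⟩)
      rw [this]
      exact P.zero_mem

theorem annihilatorNumber_faceIdeal (Γ : LowerSet (Finset (Fin n))) (i : Fin n) (j : ℤ) :
    annihilatorNumber (quotGrading (extPiece K n) (faceIdeal K Γ)) (stdBasis K n) i j =
      Set.ncard {F | F ∈ Γ ∧ (F.card : ℤ) = j ∧ Finset.Iic i ∩ F = ∅ ∧ F ∪ {i} ∉ Γ} := by
  set P := Ideal.span {x : Ext K n | ∃ k < i, x = linForm (stdBasis K n k)} •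
    (⊤ : Submodule (Ext K n) (Ext K n ⧸ faceIdeal K Γ))
  have := cohomDim_of_ker_eq_faceIdeal (Δ := deleteBelow Γ i) (P.mkQ ∘ₗ (faceIdeal K Γ).mkQ)
    (P.mkQ_surjective.comp (faceIdeal K Γ).mkQ_surjective)
    (by
      ext f
      rw [LinearMap.mem_ker, LinearMap.comp_apply, Submodule.mkQ_apply,
        Submodule.Quotient.mk_eq_zero, mk_mem_smul_top_iff])
    (quotGrading (quotGrading (extPiece K n) (faceIdeal K Γ)) P)
    (fun j => by
      unfold quotGrading
      rw [← Submodule.map_comp]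
      rfl) i j
  refine this.trans ?_
  congr 1
  ext F
  have hI : Finset.Iic i ∩ F = ∅ ↔ ∀ k ∈ F, i < k := by
    rw [Finset.eq_empty_iff_forall_notMem]
    simp only [Finset.mem_inter, Finset.mem_Iic, not_and]
    exact forall_congr' fun k => by rw [imp_not_comm, not_le]
  have hmem : ∀ G, G ∈ deleteBelow Γ i ↔ G ∈ Γ ∧ ∀ k ∈ G, i ≤ k := fun G => Iff.rfl
  simp only [Set.mem_ofPred_eq, hI, hmem, Finset.union_comm F, ← Finset.insert_eq]
  constructor
  · rintro ⟨⟨hF, hle⟩, hj, hi, hiF⟩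
    refine ⟨hF, hj, fun k hk => lt_of_le_of_ne (hle k hk) (by rintro rfl; exact hi hk), fun h => ?_⟩
    exact hiF ⟨h, by simpa using hle⟩
  · rintro ⟨hF, hj, hlt, hiF⟩
    exact ⟨⟨hF, fun k hk => (hlt k hk).le⟩, hj, fun hi => lt_irrefl i (hlt i hi), fun h => hiF h.1⟩

theorem genericAnnihilatorNumber_eq_of_gin_eq {J I : Ideal (Ext K n)} (h : gin J = I)
    (i : Fin n) (j : ℤ) : genericAnnihilatorNumber J i j =
      annihilatorNumber (quotGrading (extPiece K n) I) (stdBasis K n) i j := by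
  subst h
  rfl

end Cohomology

end ExteriorShifting

theorem corollary3p8 {K : Type*} [Field K] [Infinite K] {n : ℕ}
    (Δ : LowerSet (Finset (Fin n)))
    {K' : Type*} [Field K'] [Algebra K K'] (a : Matrix (Fin n) (Fin n) K')
    (ha : AlgebraicIndependent K (fun q : Fin n × Fin n => a q.1 q.2)) :
    (∃! I, ExteriorShifting.IsGin (ExteriorShifting.faceIdeal K Δ) I) ∧
    ∀ (i : Fin n) (j : ℤ),
      ExteriorShifting.genericAnnihilatorNumber (ExteriorShifting.faceIdeal K Δ) i j =
        Set.ncard {F : Finset (Fin n) | F ∈ ExteriorShifting.exteriorShifting a Δ ∧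
          (F.card : ℤ) = j ∧ Finset.Iic i ∩ F = ∅ ∧
          F ∪ {i} ∉ ExteriorShifting.exteriorShifting a Δ} := by
  obtain ⟨Γ, hΓ, hgin⟩ := ExteriorShifting.exists_isGin_faceIdeal Δ a ha
  refine ⟨⟨_, hgin, fun I hI => hI.unique hgin⟩, fun i j => ?_⟩
  have hgin' : ExteriorShifting.gin (ExteriorShifting.faceIdeal K Δ) =
      ExteriorShifting.faceIdeal K Γ :=
    (Classical.epsilon_spec (p := ExteriorShifting.IsGin _) ⟨_, hgin⟩).unique hgin
  rw [ExteriorShifting.genericAnnihilatorNumber_eq_of_gin_eq hgin',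
    ExteriorShifting.annihilatorNumber_faceIdeal, ← hΓ]
  rfl
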